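/- Let $G$ be a Hausdorff locally compact topological group and $K$ a compact subgroup of $G$ such that $(G,K)$ is a Gelfand pair, i.e. the convolution algebra of $K$-biinvariant integrable complex functions on $G$ (with respect to a left Haar measure, functions being identified when equal almost everywhere, and $(f*h)(x)=\int_G f(y)\,h(y^{-1}x)\,dy$) is commutative. Let $\mathcal{P}^\natural(G)$ be the convex cone of continuous functions $\varphi:G\to\mathbb{C}$ that are $K$-biinvariant ($\varphi(k_1gk_2)=\varphi(g)$ for all $k_1,k_2\in K$, $g\in G$) and of positive type, i.e. $\sum_{i,j=1}^n c_i\overline{c_j}\,\varphi(g_j^{-1}g_i)\ge 0$ for all $n$, $g_1,\dots,g_n\in G$ and $c_1,\dots,c_n\in\mathbb{C}$. Order $\mathcal{P}^\natural(G)$ by $\varphi\ll\psi$ if and only if $\psi-\varphi\in\mathcal{P}^\natural(G)$. Then $\mathcal{P}^\natural(G)$ is a lattice: any two elements $\varphi,\psi\in\mathcal{P}^\natural(G)$ have, for the order $\ll$, a least upper bound in $\mathcal{P}^\natural(G)$ and a greatest lower bound in $\mathcal{P}^\natural(G)$. -/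

import Mathlib

open MeasureTheory
open scoped ComplexOrder ComplexConjugate

/-- A function `φ : G → ℂ` is of positive type if
`∑ i, ∑ j, c i * conj (c j) * φ ((g j)⁻¹ * g i)` is real and nonnegative for all finite families
`g i` in `G` and `c i` in `ℂ`. -/
def IsPositiveType {G : Type*} [Group G] (φ : G → ℂ) : Prop :=
  ∀ (n : ℕ) (g : Fin n → G) (c : Fin n → ℂ),
    0 ≤ ∑ i, ∑ j, c i * conj (c j) * φ ((g j)⁻¹ * g i)

/-- A function on `G` is `K`-biinvariant if `φ (k₁ * g * k₂) = φ g` for `k₁, k₂ ∈ K`, `g ∈ G`. -/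
def IsBiinvariant {G E : Type*} [Group G] (K : Subgroup G) (φ : G → E) : Prop :=
  ∀ k₁ ∈ K, ∀ k₂ ∈ K, ∀ g : G, φ (k₁ * g * k₂) = φ g

/-- The convex cone of `K`-biinvariant continuous functions of positive type on `G`, in the real
vector space of all complex functions on `G`. -/
def biinvariantPositiveCone {G : Type*} [Group G] [TopologicalSpace G] (K : Subgroup G) :
    PointedCone ℝ (G → ℂ) where
  carrier := {φ | Continuous φ ∧ IsPositiveType φ ∧ IsBiinvariant K φ}
  add_mem' := by
    rintro φ ψ ⟨hφ, hφ', hφ''⟩ ⟨hψ, hψ', hψ''⟩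
    refine ⟨hφ.add hψ, fun n g c => ?_, fun k₁ h₁ k₂ h₂ g => ?_⟩
    · simpa [mul_add, Finset.sum_add_distrib] using add_nonneg (hφ' n g c) (hψ' n g c)
    · simp [hφ'' k₁ h₁ k₂ h₂ g, hψ'' k₁ h₁ k₂ h₂ g]
  zero_mem' :=
    ⟨continuous_const, fun n g c => by simp, fun k₁ _ k₂ _ g => rfl⟩
  smul_mem' := by
    rintro ⟨t, ht⟩ φ ⟨hφ, hφ', hφ''⟩
    refine ⟨hφ.const_smul t, fun n g c => ?_, fun k₁ h₁ k₂ h₂ g => ?_⟩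
    · have h := mul_nonneg (Complex.zero_le_real.mpr ht) (hφ' n g c)
      simpa [Finset.mul_sum, mul_left_comm, NNReal.smul_def] using h
    · simp [hφ'' k₁ h₁ k₂ h₂ g]

/-- The order defined by a convex cone: `x ≪ y` if `y - x` belongs to the cone. -/
def PointedCone.ConeLE {E : Type*} [AddCommGroup E] [Module ℝ E] (Γ : PointedCone ℝ E)
    (x y : E) : Prop :=
  y - x ∈ Γ

/-- A convex cone `Γ` is a lattice if any two elements of `Γ` have, for the order defined by `Γ`,
a least upper bound in `Γ` and a greatest lower bound in `Γ`. -/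
def PointedCone.IsLatticeCone {E : Type*} [AddCommGroup E] [Module ℝ E]
    (Γ : PointedCone ℝ E) : Prop :=
  ∀ x ∈ Γ, ∀ y ∈ Γ,
    (∃ s ∈ Γ, Γ.ConeLE x s ∧ Γ.ConeLE y s ∧
      ∀ u ∈ Γ, Γ.ConeLE x u → Γ.ConeLE y u → Γ.ConeLE s u) ∧
    (∃ i ∈ Γ, Γ.ConeLE i x ∧ Γ.ConeLE i y ∧
      ∀ l ∈ Γ, Γ.ConeLE l x → Γ.ConeLE l y → Γ.ConeLE l i)

/-- The convolution `(f * h) x = ∫ f y h (y⁻¹ x) dy` of two functions on a locally compact group,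
with respect to a left Haar measure. -/
noncomputable def haarConvolution {G : Type*} [Group G] [TopologicalSpace G]
    [IsTopologicalGroup G] [LocallyCompactSpace G] [MeasurableSpace G] [BorelSpace G]
    (f h : G → ℂ) (x : G) : ℂ :=
  ∫ y, f y * h (y⁻¹ * x) ∂(Measure.haar : Measure G)

/-- `(G, K)` is a Gelfand pair: `K` is a compact subgroup of the locally compact group `G` and the
convolution algebra of `K`-biinvariant integrable functions is commutative (as an algebra of
functions modulo equality almost everywhere). -/
structure IsGelfandPair (G : Type*) [Group G] [TopologicalSpace G]
    [IsTopologicalGroup G] [LocallyCompactSpace G] [MeasurableSpace G] [BorelSpace G]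
    (K : Subgroup G) : Prop where
  isCompact : IsCompact (K : Set G)
  convolution_comm : ∀ f h : G → ℂ,
    Integrable f (Measure.haar : Measure G) → IsBiinvariant K f →
    Integrable h (Measure.haar : Measure G) → IsBiinvariant K h →
    haarConvolution f h =ᵐ[(Measure.haar : Measure G)] haarConvolution h f

-- Put χ = φ + ψ and let (H, π, ξ) be its GNS triple, so that χ(g) = ⟨ξ, π(g)ξ⟩ with ξ cyclic and
-- fixed by K. The elements l of the cone with l ≪ χ correspond to positive operators L in the
-- commutant of π through l(g) = ⟨ξ, L π(g)ξ⟩, and the order ≪ becomes the operator order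
-- (`exists_nonneg_commute_of_dominated`, `mem_biinvariantPositiveCone_of_nonneg`). If A and B
-- represent φ and ψ, the candidate for the infimum is the coefficient of A - (A - B)⁺.
--
-- Positive parts give infima only among commuting operators, and this is where the Gelfand property
-- enters. It makes the compressions P π(g) P to the K-fixed vectors commute
-- (`IsGelfandPair.inner_rep_comm`). Since ξ is cyclic for them in PH, selfadjoint operators of the
-- commutant of π commute with each other (`commute_of_commute_rep`). Suprema then follow from
-- infima by translation in the ordered vector space.

universe u

/-! ### Gram families and the GNS construction. -/

section GNS

variable {G : Type*} [Group G]

/-- The positivity of a function of positive type, for families indexed by a finite set. -/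
theorem IsPositiveType.sum_nonneg {φ : G → ℂ} (hφ : IsPositiveType φ) (s : Finset G) (c : G → ℂ) :
    0 ≤ ∑ x ∈ s, ∑ y ∈ s, c x * conj (c y) * φ (y⁻¹ * x) := by
  have h := hφ s.card (fun i => (s.equivFin.symm i : G)) (fun i => c (s.equivFin.symm i))
  rw [← Finset.sum_coe_sort s]
  refine h.trans_eq (Fintype.sum_equiv s.equivFin.symm _ _ fun i => ?_)
  rw [← Finset.sum_coe_sort s]
  exact Fintype.sum_equiv s.equivFin.symm _ _ fun j => rfl

/-- A function of positive type is hermitian. -/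
theorem IsPositiveType.conj_inv {φ : G → ℂ} (hφ : IsPositiveType φ) (g : G) :
    conj (φ g⁻¹) = φ g := by
  -- Reality of the form at one point makes φ(1) real; the coefficients (1, 1) then compare the
  -- imaginary parts of φ(g) and φ(g⁻¹), and (1, i) their real parts.
  have h0 := (Complex.nonneg_iff.1 (hφ 1 ![1] ![1])).2
  have h1 := (Complex.nonneg_iff.1 (hφ 2 ![1, g] ![1, 1])).2
  have h2 := (Complex.nonneg_iff.1 (hφ 2 ![1, g] ![1, Complex.I])).2
  simp [Fin.sum_univ_two] at h0 h1 h2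
  refine Complex.ext ?_ ?_
  · simp; linarith
  · simp; linarith

/-- The kernel `(x, y) ↦ φ (x⁻¹ * y)` of a function of positive type, with values in the operators
on `ℂ`. -/
noncomputable def positiveTypeKernel (φ : G → ℂ) : Matrix G G (ℂ →L[ℂ] ℂ) :=
  Matrix.of fun x y => φ (x⁻¹ * y) • (1 : ℂ →L[ℂ] ℂ)

theorem IsPositiveType.posSemidef_kernel {φ : G → ℂ} (hφ : IsPositiveType φ) :
    (positiveTypeKernel φ).PosSemidef := by
  have key := (RKHS.posSemidef_tfae (K := positiveTypeKernel φ)).out 0 2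
  refine key.2 ⟨?_, fun c => ?_⟩
  · ext x y
    simp [positiveTypeKernel, Matrix.conjTranspose_apply, ← hφ.conj_inv (x⁻¹ * y)]
  · have h : (c.sum fun x w => c.sum fun x' w' =>
        inner ℂ ((positiveTypeKernel φ) x' x w) w') =
        conj (∑ x ∈ c.support, ∑ y ∈ c.support, c x * conj (c y) * φ (y⁻¹ * x)) := by
      simp only [Finsupp.sum, map_sum]
      refine Finset.sum_congr rfl fun x _ => Finset.sum_congr rfl fun y _ => ?_
      simp [positiveTypeKernel]
      ring
    rw [h]
    exact (Complex.nonneg_iff.1 (hφ.sum_nonneg c.support c)).1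

/-- The Gelfand–Naimark–Segal construction: a function of positive type is the Gram function of
a total family in a Hilbert space. -/
theorem IsPositiveType.exists_gram {G : Type u} [Group G] {φ : G → ℂ} (hφ : IsPositiveType φ) :
    ∃ (H : Type u) (_ : NormedAddCommGroup H) (_ : InnerProductSpace ℂ H) (_ : CompleteSpace H)
      (e : G → H), (Submodule.span ℂ (Set.range e)).topologicalClosure = ⊤ ∧
        ∀ x y, inner ℂ (e x) (e y) = φ (x⁻¹ * y) := by
  have : Fact (positiveTypeKernel φ).PosSemidef := ⟨hφ.posSemidef_kernel⟩
  refine ⟨RKHS.OfKernel (positiveTypeKernel φ), inferInstance, inferInstance, inferInstance,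
    fun x => RKHS.kerFun (RKHS.OfKernel (positiveTypeKernel φ)) x 1, ?_, fun x y => ?_⟩
  · rw [← RKHS.kerFun_dense (𝕜 := ℂ) (V := ℂ) (X := G) (RKHS.OfKernel (positiveTypeKernel φ))]
    congr 1
    refine le_antisymm (Submodule.span_mono ?_) (Submodule.span_le.2 ?_)
    · rintro _ ⟨x, rfl⟩
      exact ⟨x, 1, rfl⟩
    · rintro _ ⟨x, v, rfl⟩
      have : RKHS.kerFun (RKHS.OfKernel (positiveTypeKernel φ)) x v =
          v • RKHS.kerFun (RKHS.OfKernel (positiveTypeKernel φ)) x 1 := by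
        rw [← map_smul]; simp
      rw [this]
      exact Submodule.smul_mem _ _ (Submodule.subset_span ⟨x, rfl⟩)
  · rw [← RKHS.kernel_inner, RKHS.OfKernel.kernel_ofKernel]
    have := hφ.conj_inv (x⁻¹ * y)
    simpa [positiveTypeKernel] using this

/-- A map from a total family of vectors which does not increase the norm of linear combinations
extends to a continuous linear map. -/
theorem exists_continuousLinearMap_of_norm_le {ι H F : Type*} [NormedAddCommGroup H]
    [NormedSpace ℂ H] [NormedAddCommGroup F] [NormedSpace ℂ F] [CompleteSpace F]
    {e : ι → H} (he : (Submodule.span ℂ (Set.range e)).topologicalClosure = ⊤) (f : ι → F)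
    (h : ∀ c : ι →₀ ℂ,
      ‖Finsupp.linearCombination ℂ f c‖ ≤ ‖Finsupp.linearCombination ℂ e c‖) :
    ∃ T : H →L[ℂ] F, ∀ i, T (e i) = f i := by
  have hd : DenseRange (Finsupp.linearCombination ℂ e) := by
    rw [DenseRange, ← LinearMap.coe_range, Finsupp.range_linearCombination]
    exact Submodule.dense_iff_topologicalClosure_eq_top.2 he
  refine ⟨(Finsupp.linearCombination ℂ f).extendOfNorm (Finsupp.linearCombination ℂ e),
    fun i => ?_⟩
  have := LinearMap.extendOfNorm_eq (f := Finsupp.linearCombination ℂ f) hd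
    ⟨1, by simpa using h⟩ (Finsupp.single i 1)
  simpa using this

/-- The norm of a linear combination in terms of the Gram function. -/
theorem norm_sq_linearCombination_eq {H : Type*} [NormedAddCommGroup H] [InnerProductSpace ℂ H]
    {φ : G → ℂ} {e : G → H} (he : ∀ x y, inner ℂ (e x) (e y) = φ (x⁻¹ * y)) (c : G →₀ ℂ) :
    ((‖Finsupp.linearCombination ℂ e c‖ ^ 2 : ℝ) : ℂ) =
      ∑ x ∈ c.support, ∑ y ∈ c.support, c x * conj (c y) * φ (y⁻¹ * x) := by
  push_cast
  have := inner_self_eq_norm_sq_to_K (𝕜 := ℂ) (Finsupp.linearCombination ℂ e c)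
  rw [← Complex.coe_algebraMap]
  refine this.symm.trans ?_
  rw [Finsupp.linearCombination_apply, Finsupp.sum, inner_sum]
  refine Finset.sum_congr rfl fun x _ => ?_
  rw [sum_inner]
  refine Finset.sum_congr rfl fun y _ => ?_
  rw [inner_smul_left, inner_smul_right, he]
  ring

end GNS

/-! ### Vectors and operators determined on a total family. -/

section Total

variable {ι H : Type*} [NormedAddCommGroup H] [InnerProductSpace ℂ H] {e : ι → H}

theorem eq_of_forall_inner_total
    (he : (Submodule.span ℂ (Set.range e)).topologicalClosure = ⊤) {v w : H}
    (h : ∀ i, inner ℂ (e i) v = inner ℂ (e i) w) : v = w := by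
  have hd := Submodule.dense_iff_topologicalClosure_eq_top.2 he
  refine hd.eq_of_inner_right (𝕜 := ℂ) fun x hx => ?_
  induction hx using Submodule.span_induction with
  | mem x hx => obtain ⟨i, rfl⟩ := hx; exact h i
  | zero => simp
  | add x y _ _ hx hy => rw [inner_add_left, inner_add_left, hx, hy]
  | smul c x _ hx => rw [inner_smul_left, inner_smul_left, hx]

theorem ContinuousLinearMap.ext_total {F : Type*} [NormedAddCommGroup F] [NormedSpace ℂ F]
    (he : (Submodule.span ℂ (Set.range e)).topologicalClosure = ⊤) {S T : H →L[ℂ] F}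
    (h : ∀ i, S (e i) = T (e i)) : S = T :=
  ContinuousLinearMap.ext_on (Submodule.dense_iff_topologicalClosure_eq_top.2 he)
    (by rintro _ ⟨i, rfl⟩; exact h i)

end Total

/-! ### Unitary representations and domination of positive-type functions. -/

section Rep

variable {G H : Type*} [Group G] [NormedAddCommGroup H] [InnerProductSpace ℂ H]
  {π : G →* (H →L[ℂ] H)}

theorem MonoidHom.apply_mul_apply (g h : G) (v : H) : π (g * h) v = π g (π h v) := by
  rw [map_mul]; rfl

variable {φ : G → ℂ} {e : G → H}

/-- Expanding the square gives ‖e y - e x‖² = 2 Re φ(1) - 2 Re φ(y⁻¹x), which tends to 0 as y tends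
to x. -/
theorem continuous_gram_family [TopologicalSpace G] [IsTopologicalGroup G] (hφ : Continuous φ)
    (he : ∀ x y, inner ℂ (e x) (e y) = φ (x⁻¹ * y)) : Continuous e := by
  rw [continuous_iff_continuousAt]
  intro x
  rw [ContinuousAt, tendsto_iff_norm_sub_tendsto_zero]
  have h : ∀ y, ‖e y - e x‖ = √((φ 1).re - 2 * (φ (y⁻¹ * x)).re + (φ 1).re) := by
    intro y
    rw [← Real.sqrt_sq (norm_nonneg (e y - e x)), @norm_sub_sq ℂ, he]
    rw [← @inner_self_eq_norm_sq ℂ, ← @inner_self_eq_norm_sq ℂ, he, he]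
    simp
  simp_rw [h]
  have hc : Continuous fun y => √((φ 1).re - 2 * (φ (y⁻¹ * x)).re + (φ 1).re) := by fun_prop
  have := hc.tendsto x
  simpa [two_mul] using this

theorem rep_fixes_cyclic_vector (ht : (Submodule.span ℂ (Set.range e)).topologicalClosure = ⊤)
    (he : ∀ x y, inner ℂ (e x) (e y) = φ (x⁻¹ * y)) (hπ : ∀ g x, π g (e x) = e (g * x))
    {K : Subgroup G} (hφ : IsBiinvariant K φ) {k : G} (hk : k ∈ K) : π k (e 1) = e 1 := by
  refine eq_of_forall_inner_total ht fun x => ?_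
  have := hφ 1 K.one_mem k hk x⁻¹
  rw [hπ, he, he]
  simpa using this

variable [CompleteSpace H]

theorem inner_rep_left (hπ : ∀ g, star (π g) = π g⁻¹) (g : G) (v w : H) :
    inner ℂ (π g v) w = inner ℂ v (π g⁻¹ w) := by
  rw [← hπ, ContinuousLinearMap.star_eq_adjoint, ContinuousLinearMap.adjoint_inner_right]

theorem norm_rep_apply (hπ : ∀ g, star (π g) = π g⁻¹) (g : G) (v : H) : ‖π g v‖ = ‖v‖ := by
  have : inner ℂ (π g v) (π g v) = inner ℂ v v := by
    rw [inner_rep_left hπ, ← MonoidHom.apply_mul_apply]; simp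
  rw [@norm_eq_sqrt_re_inner ℂ, @norm_eq_sqrt_re_inner ℂ _ _ _ _ v, this]

/-- A strongly continuous unitary representation of a group on a Hilbert space. -/
structure IsUnitaryRep [TopologicalSpace G] (π : G →* (H →L[ℂ] H)) : Prop where
  star_map : ∀ g, star (π g) = π g⁻¹
  continuous_apply : ∀ v, Continuous fun g => π g v

/-- The left translations of a total family whose Gram function is left invariant define a
unitary representation. -/
theorem exists_isUnitaryRep_of_gram [TopologicalSpace G] [IsTopologicalGroup G] (hφ : Continuous φ)
    (ht : (Submodule.span ℂ (Set.range e)).topologicalClosure = ⊤)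
    (he : ∀ x y, inner ℂ (e x) (e y) = φ (x⁻¹ * y)) :
    ∃ π : G →* (H →L[ℂ] H), IsUnitaryRep π ∧ ∀ g x, π g (e x) = e (g * x) := by
  have hex : ∀ g : G, ∃ T : H →L[ℂ] H, ∀ x, T (e x) = e (g * x) := by
    intro g
    refine exists_continuousLinearMap_of_norm_le ht (fun x => e (g * x)) fun c => ?_
    have h1 := norm_sq_linearCombination_eq he c
    have h2 := norm_sq_linearCombination_eq (e := fun x => e (g * x)) (φ := φ)
      (fun x y => by rw [he]; group) c
    rw [← h1] at h2
    exact ((sq_eq_sq₀ (norm_nonneg _) (norm_nonneg _)).1 (by exact_mod_cast h2)).le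
  choose T hT using hex
  let π : G →* (H →L[ℂ] H) :=
    { toFun := T
      map_one' := ContinuousLinearMap.ext_total ht fun x => by simp [hT]
      map_mul' := fun g h => ContinuousLinearMap.ext_total ht fun x => by simp [hT, mul_assoc] }
  have hπ : ∀ g x, π g (e x) = e (g * x) := hT
  have hs : ∀ g, star (π g) = π g⁻¹ := by
    intro g
    refine ContinuousLinearMap.ext_total ht fun x => eq_of_forall_inner_total ht fun y => ?_
    rw [ContinuousLinearMap.star_eq_adjoint, ContinuousLinearMap.adjoint_inner_right, hπ, hπ, he,
      he]
    group
  refine ⟨π, ⟨hs, fun v => ?_⟩, hT⟩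
  have hd := Submodule.dense_iff_topologicalClosure_eq_top.2 ht
  have hspan : ∀ w ∈ Submodule.span ℂ (Set.range e), Continuous fun g => π g w := by
    intro w hw
    induction hw using Submodule.span_induction with
    | mem x hx =>
      obtain ⟨x, rfl⟩ := hx
      simp_rw [hπ]
      exact (continuous_gram_family hφ he).comp (continuous_mul_const x)
    | zero => simpa using continuous_const
    | add x y _ _ hx hy => simp only [map_add]; exact hx.add hy
    | smul c x _ hx => simp only [map_smul]; exact hx.const_smul c
  -- Each π(g) is isometric, so approximating v by w in the span approximates the orbit map of v
  -- uniformly in g.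
  refine continuous_of_uniform_approx_of_continuous fun u hu => ?_
  obtain ⟨ε, hε, hu⟩ := Metric.mem_uniformity_dist.1 hu
  obtain ⟨w, hw, hvw⟩ := Metric.mem_closure_iff.1 (hd v) ε hε
  refine ⟨_, hspan w hw, fun g => hu ?_⟩
  rwa [dist_eq_norm, ← map_sub, norm_rep_apply hs, ← dist_eq_norm]

/-- A function of positive type dominated by the Gram function of a total family is a matrix
coefficient of a positive operator commuting with the translations. -/
theorem exists_nonneg_commute_of_dominated {G H : Type u} [Group G] [NormedAddCommGroup H]
    [InnerProductSpace ℂ H] [CompleteSpace H] {π : G →* (H →L[ℂ] H)} {φ ψ : G → ℂ} {e : G → H}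
    (ht : (Submodule.span ℂ (Set.range e)).topologicalClosure = ⊤)
    (he : ∀ x y, inner ℂ (e x) (e y) = φ (x⁻¹ * y)) (hs : ∀ g, star (π g) = π g⁻¹)
    (hπ : ∀ g x, π g (e x) = e (g * x)) (hψ : IsPositiveType ψ) (hφψ : IsPositiveType (φ - ψ)) :
    ∃ L : H →L[ℂ] H, 0 ≤ L ∧ (∀ g, Commute L (π g)) ∧
      ∀ x y, inner ℂ (e x) (L (e y)) = ψ (x⁻¹ * y) := by
  obtain ⟨H', _, _, _, e', -, he'⟩ := hψ.exists_gram
  -- The form of φ - ψ at c is the difference of the squared norms in H and H', so e x ↦ e' x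
  -- extends to a contraction T; the required operator is T*T.
  obtain ⟨T, hT⟩ := exists_continuousLinearMap_of_norm_le ht e' fun c => by
    have h1 := norm_sq_linearCombination_eq he c
    have h2 := norm_sq_linearCombination_eq he' c
    have h3 := hφψ.sum_nonneg c.support c
    have h4 : ∑ x ∈ c.support, ∑ y ∈ c.support, c x * conj (c y) * (φ - ψ) (y⁻¹ * x) =
        ((‖Finsupp.linearCombination ℂ e c‖ ^ 2 - ‖Finsupp.linearCombination ℂ e' c‖ ^ 2 : ℝ) :
          ℂ) := by
      rw [Complex.ofReal_sub, h1, h2]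
      simp [mul_sub, Finset.sum_sub_distrib]
    rw [h4, Complex.zero_le_real, sub_nonneg] at h3
    exact (sq_le_sq₀ (norm_nonneg _) (norm_nonneg _)).1 h3
  have hL : ∀ x y, inner ℂ (e x) ((ContinuousLinearMap.adjoint T ∘L T) (e y)) = ψ (x⁻¹ * y) := by
    intro x y
    rw [ContinuousLinearMap.comp_apply, ContinuousLinearMap.adjoint_inner_right, hT, hT, he']
  refine ⟨ContinuousLinearMap.adjoint T ∘L T, ?_, fun g => ?_, hL⟩
  · exact ContinuousLinearMap.nonneg_iff_isPositive _ |>.2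
      (ContinuousLinearMap.isPositive_adjoint_comp_self T)
  · refine ContinuousLinearMap.ext_total ht fun y => eq_of_forall_inner_total ht fun x => ?_
    change inner ℂ (e x) ((ContinuousLinearMap.adjoint T ∘L T) (π g (e y))) =
      inner ℂ (e x) (π g ((ContinuousLinearMap.adjoint T ∘L T) (e y)))
    have := inner_rep_left hs g⁻¹ (e x) ((ContinuousLinearMap.adjoint T ∘L T) (e y))
    rw [inv_inv] at this
    rw [← this, hπ, hπ, hL, hL]
    group

/-- The diagonal matrix coefficients of a positive operator commuting with a unitary
representation, at a vector fixed by `K`, lie in the cone of biinvariant functions of positive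
type. -/
theorem mem_biinvariantPositiveCone_of_nonneg [TopologicalSpace G] (hπ : IsUnitaryRep π)
    {K : Subgroup G} {ξ : H} (hξ : ∀ k ∈ K, π k ξ = ξ) {A : H →L[ℂ] H} (hA : 0 ≤ A)
    (hc : ∀ g, Commute A (π g)) :
    (fun g => inner ℂ ξ (A (π g ξ))) ∈ biinvariantPositiveCone K := by
  have hc' : ∀ g v, A (π g v) = π g (A v) := fun g v => DFunLike.congr_fun (hc g) v
  have hi : ∀ g h, inner ℂ ξ (A (π (h⁻¹ * g) ξ)) = inner ℂ (π h ξ) (A (π g ξ)) := by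
    intro g h
    rw [inner_rep_left hπ.star_map, ← hc', MonoidHom.apply_mul_apply]
  refine ⟨?_, fun n g c => ?_, fun k₁ h₁ k₂ h₂ g => ?_⟩
  · exact continuous_const.inner (A.continuous.comp (hπ.continuous_apply ξ))
  · have h := ((ContinuousLinearMap.nonneg_iff_isPositive A).1 hA).inner_nonneg_right
      (∑ i, c i • π (g i) ξ)
    refine h.trans_eq ?_
    rw [map_sum, inner_sum]
    refine Finset.sum_congr rfl fun i _ => ?_
    rw [sum_inner]
    refine Finset.sum_congr rfl fun j _ => ?_
    rw [map_smul, inner_smul_left, inner_smul_right, ← hi]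
    ring
  · have h1 : π (k₁ * g * k₂) ξ = π (k₁ * g) ξ := by
      rw [MonoidHom.apply_mul_apply, hξ k₂ h₂]
    have h2 := hi g k₁⁻¹
    rw [inv_inv, hξ _ (K.inv_mem h₁)] at h2
    simp only [h1, h2]

end Rep

/-! ### Integrated representations and commuting compressions for a Gelfand pair. -/

section Gelfand

variable {G : Type*} [Group G] [TopologicalSpace G] [IsTopologicalGroup G]
  [LocallyCompactSpace G]

/-- There are biinvariant bump functions for a compact subgroup of a locally compact group. -/
theorem exists_isBiinvariant_bump {K : Subgroup G} (hK : IsCompact (K : Set G)) (x : G) :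
    ∃ η : G → ℝ, Continuous η ∧ HasCompactSupport η ∧ 0 ≤ η ∧ IsBiinvariant K η ∧ η x ≠ 0 := by
  obtain ⟨η, hηc, hη0, hηx⟩ := exists_continuous_nonneg_pos x
  have hKK : IsCompact ((K : Set G) ×ˢ (K : Set G)) := hK.prod hK
  -- A supremum over K × K replaces averaging over K: it is biinvariant without any measure on K,
  -- and compactness of K × K keeps it continuous.
  let F : G → G × G → ℝ := fun g p => η (p.1 * g * p.2)
  have hF : Continuous (Function.uncurry F) := by
    simp only [F, Function.uncurry_def]
    fun_prop
  have hb : ∀ g, BddAbove (F g '' ((K : Set G) ×ˢ (K : Set G))) := fun g =>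
    (hKK.image (hF.comp (Continuous.prodMk_right g))).bddAbove
  have hnn : ∀ g, 0 ≤ sSup (F g '' ((K : Set G) ×ˢ (K : Set G))) := by
    intro g
    apply Real.sSup_nonneg
    rintro _ ⟨p, -, rfl⟩
    exact hη0 _
  refine ⟨fun g => sSup (F g '' ((K : Set G) ×ˢ (K : Set G))), hKK.continuous_sSup hF, ?_, hnn,
    fun k₁ h₁ k₂ h₂ g => ?_, ?_⟩
  · refine HasCompactSupport.intro ((hK.mul hηc).mul hK) fun g hg => ?_
    have : F g '' ((K : Set G) ×ˢ (K : Set G)) ⊆ {0} := by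
      rintro _ ⟨⟨k, l⟩, ⟨hk, hl⟩, rfl⟩
      by_contra hne
      refine hg ?_
      have : g = k⁻¹ * (k * g * l) * l⁻¹ := by group
      rw [this]
      exact Set.mul_mem_mul (Set.mul_mem_mul (K.inv_mem hk) (subset_tsupport _ hne))
        (K.inv_mem hl)
    exact le_antisymm (Real.sSup_le (fun y hy => (this hy).le) le_rfl) (hnn g)
  · refine congrArg sSup (Set.ext fun t => ?_)
    constructor
    · rintro ⟨⟨k, l⟩, ⟨hk, hl⟩, rfl⟩
      refine ⟨(k * k₁, k₂ * l), ⟨K.mul_mem hk h₁, K.mul_mem h₂ hl⟩, ?_⟩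
      simp only [F, mul_assoc]
    · rintro ⟨⟨k, l⟩, ⟨hk, hl⟩, rfl⟩
      refine ⟨(k * k₁⁻¹, k₂⁻¹ * l), ⟨K.mul_mem hk (K.inv_mem h₁), K.mul_mem (K.inv_mem h₂) hl⟩, ?_⟩
      simp only [F]
      congr 1
      group
  · have h1 : η x ≤ sSup (F x '' ((K : Set G) ×ˢ (K : Set G))) :=
      le_csSup (hb x) ⟨(1, 1), ⟨K.one_mem, K.one_mem⟩, by simp [F]⟩
    exact ((lt_of_le_of_ne (hη0 x) hηx.symm).trans_le h1).ne'

variable [MeasurableSpace G] [BorelSpace G]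

/-- A continuous biinvariant function orthogonal to all biinvariant functions with compact support
vanishes. -/
theorem eq_zero_of_forall_integral_mul_eq_zero {K : Subgroup G} (hK : IsCompact (K : Set G))
    {Ψ : G → ℂ} (hΨ : Continuous Ψ) (hb : IsBiinvariant K Ψ)
    (h : ∀ f : G → ℂ, Continuous f → HasCompactSupport f → IsBiinvariant K f →
      ∫ x, f x * Ψ x ∂(Measure.haar : Measure G) = 0) (x : G) : Ψ x = 0 := by
  obtain ⟨η, hη, hηc, hη0, hηb, hηx⟩ := exists_isBiinvariant_bump hK x
  -- This test function turns the integrand into η|Ψ|², which is nonnegative, continuous and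
  -- positive at x if Ψ x ≠ 0.
  have h1 := h (fun y => η y * conj (Ψ y)) (by fun_prop)
    (HasCompactSupport.mul_right (hηc.comp_left (g := fun t : ℝ => (t : ℂ)) rfl))
    fun k₁ h₁ k₂ h₂ g => by simp only [hηb k₁ h₁ k₂ h₂ g, hb k₁ h₁ k₂ h₂ g]
  have h2 : ∀ y, η y * conj (Ψ y) * Ψ y = ((η y * ‖Ψ y‖ ^ 2 : ℝ) : ℂ) := by
    intro y
    rw [mul_assoc, Complex.conj_mul']
    push_cast
    rfl
  simp_rw [h2] at h1
  rw [integral_complex_ofReal, Complex.ofReal_eq_zero] at h1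
  by_contra hne
  refine h1.not_gt (Continuous.integral_pos_of_hasCompactSupport_nonneg_nonzero (x := x)
    (by fun_prop) hηc.mul_right (fun y => mul_nonneg (hη0 y) (by positivity)) ?_)
  have : ‖Ψ x‖ ≠ 0 := norm_ne_zero_iff.2 hne
  positivity

variable {H : Type*} [NormedAddCommGroup H] [InnerProductSpace ℂ H] [CompleteSpace H]
  {π : G →* (H →L[ℂ] H)}

theorem integrable_smul_rep (hπ : IsUnitaryRep π) {f : G → ℂ} (hf : Continuous f)
    (hfc : HasCompactSupport f) (v : H) :
    Integrable (fun y => f y • π y v) (Measure.haar : Measure G) :=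
  (hf.smul (hπ.continuous_apply v)).integrable_of_hasCompactSupport hfc.smul_right

/-- The integrated form of a unitary representation. -/
theorem exists_integrated_operator (hπ : IsUnitaryRep π) {f : G → ℂ} (hf : Continuous f)
    (hfc : HasCompactSupport f) :
    ∃ T : H →L[ℂ] H, ∀ v, T v = ∫ y, f y • π y v ∂(Measure.haar : Measure G) := by
  refine ⟨LinearMap.mkContinuous
    { toFun := fun v => ∫ y, f y • π y v ∂(Measure.haar : Measure G)
      map_add' := fun v w => ?_
      map_smul' := fun c v => ?_ } (∫ y, ‖f y‖ ∂(Measure.haar : Measure G)) fun v => ?_,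
    fun v => rfl⟩
  · rw [← integral_add (integrable_smul_rep hπ hf hfc v) (integrable_smul_rep hπ hf hfc w)]
    simp only [map_add, smul_add]
  · rw [RingHom.id_apply, ← integral_smul]
    simp only [map_smul, smul_comm c]
  · refine (norm_integral_le_integral_norm _).trans_eq ?_
    rw [← integral_mul_const]
    simp only [norm_smul, norm_rep_apply hπ.star_map]

/-- The integrated form of a unitary representation turns convolution into composition. -/
theorem integral_haarConvolution_smul_rep (hπ : IsUnitaryRep π) {f h : G → ℂ} (hf : Continuous f)
    (hfc : HasCompactSupport f) (hh : Continuous h) (hhc : HasCompactSupport h) (u : H) :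
    ∫ x, haarConvolution f h x • π x u ∂(Measure.haar : Measure G) =
      ∫ y, f y • π y (∫ z, h z • π z u ∂(Measure.haar : Measure G))
        ∂(Measure.haar : Measure G) := by
  have h1 : ∀ y, π y (∫ z, h z • π z u ∂(Measure.haar : Measure G)) =
      ∫ x, h (y⁻¹ * x) • π x u ∂(Measure.haar : Measure G) := by
    intro y
    rw [← ContinuousLinearMap.integral_comp_comm _ (integrable_smul_rep hπ hh hhc u)]
    rw [← integral_mul_left_eq_self (fun z => π y (h z • π z u)) y⁻¹]
    congr 1 with x
    rw [map_smul, ← MonoidHom.apply_mul_apply, mul_inv_cancel_left]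
  simp_rw [h1, haarConvolution, ← integral_smul_const, ← integral_smul, smul_smul]
  -- Haar measure need not be σ-finite here; the exchange rests on the integrand being continuous
  -- with support in (supp f · supp h) × supp f.
  refine integral_integral_swap_of_hasCompactSupport
    (f := fun x y => (f y * h (y⁻¹ * x)) • π x u) ?_ ?_
  · have := hπ.continuous_apply u
    simp only [Function.uncurry_def]
    fun_prop
  · refine HasCompactSupport.intro ((hfc.mul hhc).prod hfc) fun ⟨x, y⟩ hxy => ?_
    by_contra hne
    have hne' : f y ≠ 0 ∧ h (y⁻¹ * x) ≠ 0 := by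
      constructor <;> intro h0 <;> simp [h0] at hne
    refine hxy ⟨?_, subset_tsupport _ hne'.1⟩
    have : x = y * (y⁻¹ * x) := by group
    change x ∈ _
    rw [this]
    exact Set.mul_mem_mul (subset_tsupport _ hne'.1) (subset_tsupport _ hne'.2)

theorem IsGelfandPair.integral_smul_rep_comm {K : Subgroup G} (hGK : IsGelfandPair G K)
    (hπ : IsUnitaryRep π) {f h : G → ℂ} (hf : Continuous f) (hfc : HasCompactSupport f)
    (hfb : IsBiinvariant K f) (hh : Continuous h) (hhc : HasCompactSupport h)
    (hhb : IsBiinvariant K h) (u : H) :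
    ∫ y, f y • π y (∫ z, h z • π z u ∂(Measure.haar : Measure G)) ∂(Measure.haar : Measure G) =
    ∫ y, h y • π y (∫ z, f z • π z u ∂(Measure.haar : Measure G)) ∂(Measure.haar : Measure G) := by
  rw [← integral_haarConvolution_smul_rep hπ hf hfc hh hhc,
    ← integral_haarConvolution_smul_rep hπ hh hhc hf hfc]
  refine integral_congr_ae ?_
  filter_upwards [hGK.convolution_comm f h (hf.integrable_of_hasCompactSupport hfc) hfb
    (hh.integrable_of_hasCompactSupport hhc) hhb] with x hx
  rw [hx]

theorem integral_smul_rep_fixed (hπ : IsUnitaryRep π) {K : Subgroup G} {f : G → ℂ}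
    (hf : Continuous f) (hfc : HasCompactSupport f) (hfb : IsBiinvariant K f) (u : H) {k : G}
    (hk : k ∈ K) :
    π k (∫ y, f y • π y u ∂(Measure.haar : Measure G)) =
      ∫ y, f y • π y u ∂(Measure.haar : Measure G) := by
  rw [← ContinuousLinearMap.integral_comp_comm _ (integrable_smul_rep hπ hf hfc u),
    ← integral_mul_left_eq_self (fun y => f y • π y u) k]
  congr 1 with y
  have := hfb k hk 1 K.one_mem y
  rw [mul_one] at this
  rw [map_smul, ← MonoidHom.apply_mul_apply, this]

theorem integral_mul_inner_rep (hπ : IsUnitaryRep π) {f : G → ℂ} (hf : Continuous f)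
    (hfc : HasCompactSupport f) (S : H →L[ℂ] H) (u v : H) :
    ∫ y, f y * inner ℂ v (S (π y u)) ∂(Measure.haar : Measure G) =
      inner ℂ v (S (∫ y, f y • π y u ∂(Measure.haar : Measure G))) := by
  rw [← ContinuousLinearMap.integral_comp_comm _ (integrable_smul_rep hπ hf hfc u),
    ← integral_inner (S.integrable_comp (integrable_smul_rep hπ hf hfc u))]
  simp only [map_smul, inner_smul_right]

theorem integrable_mul_inner_rep (hπ : IsUnitaryRep π) {f : G → ℂ} (hf : Continuous f)
    (hfc : HasCompactSupport f) (S : H →L[ℂ] H) (u v : H) :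
    Integrable (fun y => f y * inner ℂ v (S (π y u))) (Measure.haar : Measure G) :=
  (hf.mul (continuous_const.inner (S.continuous.comp
    (hπ.continuous_apply u)))).integrable_of_hasCompactSupport hfc.mul_right

/-- For a Gelfand pair, the compressions `P * π y * P` of the operators of a unitary
representation to the space of vectors fixed by `K` commute with each other. -/
theorem IsGelfandPair.inner_rep_comm {K : Subgroup G} (hGK : IsGelfandPair G K)
    (hπ : IsUnitaryRep π) {P : H →L[ℂ] H} (hP : ∀ k ∈ K, π k * P = P) (hP' : ∀ k ∈ K, P * π k = P)
    (hPv : ∀ v, (∀ k ∈ K, π k v = v) → P v = v) {u v : H} (hu : ∀ k ∈ K, π k u = u)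
    (hv : ∀ k ∈ K, π k v = v) (y z : G) :
    inner ℂ v (π y (P (π z u))) = inner ℂ v (π z (P (π y u))) := by
  have hPl : ∀ k ∈ K, ∀ w, π k (P w) = P w := fun k hk w => DFunLike.congr_fun (hP k hk) w
  have hPr : ∀ k ∈ K, ∀ w, P (π k w) = P w := fun k hk w => DFunLike.congr_fun (hP' k hk) w
  have hvl : ∀ k ∈ K, ∀ w, inner ℂ v (π k w) = inner ℂ v w := by
    intro k hk w
    have := inner_rep_left hπ.star_map k⁻¹ v w
    rw [inv_inv] at this
    rw [← this, hv _ (K.inv_mem hk)]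
  -- The difference of the two sides is biinvariant in y and in z, so it may be tested in each
  -- variable. Testing against f in y and h in z leaves ⟨v, T_f P T_h u⟩ - ⟨v, T_h P T_f u⟩, where
  -- T_f denotes the integrated operator of f. Here P drops out because T_f u and T_h u are K-fixed,
  -- and T_f T_h u = T_h T_f u by commutativity of convolution.
  have key : ∀ f : G → ℂ, Continuous f → HasCompactSupport f → IsBiinvariant K f → ∀ z,
      ∫ y, f y * (inner ℂ v (π y (P (π z u))) - inner ℂ v (π z (P (π y u))))
        ∂(Measure.haar : Measure G) = 0 := by
    intro f hf hfc hfb z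
    obtain ⟨T, hT⟩ := exists_integrated_operator hπ hf hfc
    have e1 : ∀ z, ∫ y, f y * (inner ℂ v (π y (P (π z u))) - inner ℂ v (π z (P (π y u))))
        ∂(Measure.haar : Measure G) =
        inner ℂ v ((T * P) (π z u)) - inner ℂ v (π z (P (T u))) := by
      intro z
      simp_rw [mul_sub]
      have i1 := integrable_mul_inner_rep hπ hf hfc 1 (P (π z u)) v
      have i2 := integrable_mul_inner_rep hπ hf hfc (π z * P) u v
      have j1 := integral_mul_inner_rep hπ hf hfc 1 (P (π z u)) v
      have j2 := integral_mul_inner_rep hπ hf hfc (π z * P) u v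
      refine (integral_sub i1 i2).trans ?_
      rw [j1, j2, ← hT, ← hT]
      rfl
    have hTk : ∀ k ∈ K, ∀ w, π k (T w) = T w := fun k hk w => by
      rw [hT]; exact integral_smul_rep_fixed hπ hf hfc hfb w hk
    rw [e1]
    refine eq_zero_of_forall_integral_mul_eq_zero hGK.isCompact
      (Ψ := fun z => inner ℂ v ((T * P) (π z u)) - inner ℂ v (π z (P (T u)))) ?_ ?_ ?_ z
    · exact (continuous_const.inner ((T * P).continuous.comp (hπ.continuous_apply u))).sub
        (continuous_const.inner (hπ.continuous_apply _))
    · intro k₁ h₁ k₂ h₂ g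
      simp only [MonoidHom.apply_mul_apply, hu k₂ h₂, hPl k₂ h₂, hvl k₁ h₁,
        mul_apply_eq_comp, hPr k₁ h₁]
    · intro h hh hhc hhb
      simp_rw [mul_sub]
      have i1 := integrable_mul_inner_rep hπ hh hhc (T * P) u v
      have i2 := integrable_mul_inner_rep hπ hh hhc 1 (P (T u)) v
      have j1 := integral_mul_inner_rep hπ hh hhc (T * P) u v
      have j2 := integral_mul_inner_rep hπ hh hhc 1 (P (T u)) v
      refine (integral_sub i1 i2).trans ?_
      rw [j1, j2, sub_eq_zero]
      have e2 := hGK.integral_smul_rep_comm hπ hf hfc hfb hh hhc hhb u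
      rw [mul_apply_eq_comp, one_apply_eq_self,
        hPv _ (fun k hk => integral_smul_rep_fixed hπ hh hhc hhb u hk),
        hPv _ (fun k hk => hTk k hk u), hT, hT, e2]
  rw [← sub_eq_zero]
  refine eq_zero_of_forall_integral_mul_eq_zero hGK.isCompact
    (Ψ := fun y => inner ℂ v (π y (P (π z u))) - inner ℂ v (π z (P (π y u)))) ?_ ?_
    (fun f hf hfc hfb => key f hf hfc hfb z) y
  · exact (continuous_const.inner (hπ.continuous_apply _)).sub
      (continuous_const.inner ((π z * P).continuous.comp (hπ.continuous_apply u)))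
  · intro k₁ h₁ k₂ h₂ g
    simp only [MonoidHom.apply_mul_apply, hu k₂ h₂, hPl k₂ h₂, hvl k₁ h₁, hPr k₁ h₁]

end Gelfand

/-! ### Commutativity of the commutant. -/

section Commutant

open Filter Topology

variable {G H : Type*} [Group G] [NormedAddCommGroup H] [InnerProductSpace ℂ H] [CompleteSpace H]
  {π : G →* (H →L[ℂ] H)}

/-- The orthogonal projection onto the vectors fixed by a subgroup. -/
theorem exists_fixed_projection (hs : ∀ g, star (π g) = π g⁻¹) (K : Subgroup G) :
    ∃ P : H →L[ℂ] H, star P = P ∧ (∀ k ∈ K, π k * P = P) ∧ (∀ k ∈ K, P * π k = P) ∧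
      ∀ v, (∀ k ∈ K, π k v = v) → P v = v := by
  let V : Submodule ℂ H := ⨅ k : K, LinearMap.ker ((π k - 1 : H →L[ℂ] H) : H →ₗ[ℂ] H)
  have hV : ∀ v, v ∈ V ↔ ∀ k ∈ K, π k v = v := by
    intro v
    simp [V, Submodule.mem_iInf, sub_eq_zero]
  have hVc : IsClosed (V : Set H) := by
    simp only [V, Submodule.coe_iInf]
    exact isClosed_iInter fun k => (π k - 1 : H →L[ℂ] H).isClosed_ker
  have : CompleteSpace V := hVc.completeSpace_coe
  have h1 : star V.starProjection = V.starProjection := isSelfAdjoint_starProjection V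
  have h2 : ∀ k ∈ K, π k * V.starProjection = V.starProjection := by
    intro k hk
    ext v
    exact (hV _).1 (Submodule.starProjection_apply_mem V v) k hk
  refine ⟨V.starProjection, h1, h2, fun k hk => ?_, fun v hv => ?_⟩
  · have := congrArg star (h2 k⁻¹ (K.inv_mem hk))
    rwa [star_mul, h1, hs, inv_inv] at this
  · exact Submodule.starProjection_eq_self_iff.2 ((hV v).2 hv)

/-- If the compressions of a unitary representation to the vectors fixed by `K` commute with each
other and there is a cyclic vector fixed by `K`, then the selfadjoint operators commuting with the
representation commute with each other. -/
theorem commute_of_commute_rep (hs : ∀ g, star (π g) = π g⁻¹) {K : Subgroup G} {P : H →L[ℂ] H}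
    (hPs : star P = P) (hP : ∀ k ∈ K, π k * P = P) (hPv : ∀ v, (∀ k ∈ K, π k v = v) → P v = v)
    (hcomm : ∀ u v, (∀ k ∈ K, π k u = u) → (∀ k ∈ K, π k v = v) → ∀ y z,
      inner ℂ v (π y (P (π z u))) = inner ℂ v (π z (P (π y u))))
    {ξ : H} (hξ : ∀ k ∈ K, π k ξ = ξ)
    (ht : (Submodule.span ℂ (Set.range fun g => π g ξ)).topologicalClosure = ⊤)
    {A B : H →L[ℂ] H} (hA : star A = A) (hB : star B = B) (hAπ : ∀ g, Commute A (π g))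
    (hBπ : ∀ g, Commute B (π g)) : Commute A B := by
  have hPl : ∀ w, ∀ k ∈ K, π k (P w) = P w := fun w k hk => DFunLike.congr_fun (hP k hk) w
  have hPP : P * P = P := by
    ext w
    exact hPv _ (hPl w)
  have hadj : ∀ (S : H →L[ℂ] H) (v w : H), inner ℂ (S v) w = inner ℂ v (star S w) := by
    intro S v w
    rw [ContinuousLinearMap.star_eq_adjoint, ContinuousLinearMap.adjoint_inner_right]
  have hPA : ∀ {C : H →L[ℂ] H}, star C = C → (∀ g, Commute C (π g)) → Commute C P := by
    intro C hC hCπ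
    -- C preserves the K-fixed vectors, so PCP = CP; taking adjoints gives PCP = PC.
    have h1 : P * (C * P) = C * P := by
      ext w
      refine hPv _ fun k hk => ?_
      have := DFunLike.congr_fun (hCπ k) (P w)
      simp only [mul_apply_eq_comp] at this
      change π k (C (P w)) = C (P w)
      rw [← this, hPl w k hk]
    have h2 := congrArg star h1
    simp only [star_mul, hC, hPs] at h2
    rw [Commute, SemiconjBy, ← h1, ← h2, mul_assoc]
  let T : G → (H →L[ℂ] H) := fun g => P * π g * P
  have hTT : ∀ g h, T g * T h = T h * T g := by
    intro g h
    ext w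
    refine ext_inner_left ℂ fun v => ?_
    have := hcomm (P w) (P v) (hPl w) (hPl v) g h
    rw [hadj, hadj, hPs] at this
    have hPP' : ∀ x, P (P x) = P x := fun x => DFunLike.congr_fun hPP x
    simpa [T, hPP'] using this
  have hTs : ∀ g, star (T g) = T g⁻¹ := by
    intro g
    simp only [T, star_mul, hs, hPs, mul_assoc]
  let 𝒜 : Submodule ℂ (H →L[ℂ] H) := Submodule.span ℂ (Set.range T)
  have h𝒜s : ∀ a ∈ 𝒜, star a ∈ 𝒜 := by
    intro a ha
    induction ha using Submodule.span_induction with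
    | mem x hx =>
      obtain ⟨g, rfl⟩ := hx
      exact hTs g ▸ Submodule.subset_span ⟨g⁻¹, rfl⟩
    | zero => simp
    | add x y _ _ hx hy => rw [star_add]; exact 𝒜.add_mem hx hy
    | smul c x _ hx => rw [star_smul]; exact 𝒜.smul_mem _ hx
  have h𝒜of : ∀ C : H →L[ℂ] H, (∀ g, Commute C (T g)) → ∀ a ∈ 𝒜, Commute C a := by
    intro C hC a ha
    induction ha using Submodule.span_induction with
    | mem x hx => obtain ⟨g, rfl⟩ := hx; exact hC g
    | zero => exact Commute.zero_right _
    | add x y _ _ hx hy => exact hx.add_right hy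
    | smul c x _ hx => exact hx.smul_right c
  have h𝒜c : ∀ a ∈ 𝒜, ∀ b ∈ 𝒜, Commute a b := fun a ha b hb =>
    h𝒜of a (fun g => (h𝒜of (T g) (fun h => hTT g h) a ha).symm) b hb
  -- Applying P to combinations of the π(g)ξ yields combinations of the T(g)ξ, so cyclicity of ξ
  -- passes to PH.
  have hdense : ∀ w, P w = w → w ∈ closure ((fun a : H →L[ℂ] H => a ξ) '' 𝒜) := by
    intro w hw
    have h1 : w ∈ closure (Submodule.span ℂ (Set.range fun g => π g ξ) : Set H) :=
      Submodule.dense_iff_topologicalClosure_eq_top.2 ht w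
    have h2 := image_closure_subset_closure_image P.continuous ⟨w, h1, hw⟩
    refine closure_mono ?_ h2
    rintro _ ⟨x, hx, rfl⟩
    induction hx using Submodule.span_induction with
    | mem x hx =>
      obtain ⟨g, rfl⟩ := hx
      exact ⟨T g, Submodule.subset_span ⟨g, rfl⟩, by simp [T, hPv ξ hξ]⟩
    | zero => exact ⟨0, 𝒜.zero_mem, by simp⟩
    | add x y _ _ hx hy =>
      obtain ⟨a, ha, hax⟩ := hx
      obtain ⟨b, hb, hby⟩ := hy
      exact ⟨a + b, 𝒜.add_mem ha hb, by simp_all⟩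
    | smul c x _ hx =>
      obtain ⟨a, ha, hax⟩ := hx
      exact ⟨c • a, 𝒜.smul_mem c ha, by simp_all⟩
  have hCT : ∀ {C : H →L[ℂ] H}, star C = C → (∀ g, Commute C (π g)) → ∀ a ∈ 𝒜, Commute C a :=
    fun hC hCπ => h𝒜of _ fun g =>
      ((hPA hC hCπ).mul_right (hCπ g)).mul_right (hPA hC hCπ)
  have happrox : ∀ {C : H →L[ℂ] H}, star C = C → (∀ g, Commute C (π g)) →
      ∃ a : ℕ → (H →L[ℂ] H), (∀ n, a n ∈ 𝒜) ∧ Tendsto (fun n => a n ξ) atTop (𝓝 (C ξ)) ∧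
        Tendsto (fun n => star (a n) ξ) atTop (𝓝 (C ξ)) := by
    intro C hC hCπ
    have hPC : P (C ξ) = C ξ := by
      have := DFunLike.congr_fun (hPA hC hCπ) ξ
      simp only [mul_apply_eq_comp] at this
      rw [← this, hPv ξ hξ]
    obtain ⟨x, hx, hlim⟩ := mem_closure_iff_seq_limit.1 (hdense _ hPC)
    choose a ha hax using hx
    have hlim' : Tendsto (fun n => a n ξ) atTop (𝓝 (C ξ)) := by
      refine hlim.congr fun n => ?_
      exact (hax n).symm
    refine ⟨a, ha, hlim', ?_⟩
    rw [tendsto_iff_norm_sub_tendsto_zero] at hlim' ⊢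
    refine hlim'.congr fun n => ?_
    -- Normality gives ‖(aₙ - C)*ξ‖ = ‖(aₙ - C)ξ‖, so the adjoints converge at ξ along the same
    -- sequence.
    have hn : IsStarNormal (a n - C) := by
      refine ⟨?_⟩
      rw [star_sub, hC]
      have h1 := hCT hC hCπ _ (ha n)
      have h2 := hCT hC hCπ _ (h𝒜s _ (ha n))
      have h3 := h𝒜c _ (h𝒜s _ (ha n)) _ (ha n)
      exact (h3.sub_right h2.symm).sub_left (h1.sub_right (Commute.refl C))
    have h4 := ContinuousLinearMap.isStarNormal_iff_norm_eq_adjoint.1 hn ξ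
    rw [← ContinuousLinearMap.star_eq_adjoint, star_sub, hC] at h4
    simpa using h4
  obtain ⟨a, ha, hal, has⟩ := happrox hA hAπ
  obtain ⟨b, hb, hbl, hbs⟩ := happrox hB hBπ
  have hvec : A (B ξ) = B (A ξ) := by
    refine eq_of_forall_inner_total ht fun g => ?_
    have hfix : ∀ {C D : H →L[ℂ] H}, star C = C → star D = D → (∀ g, Commute C (π g)) →
        (∀ g, Commute D (π g)) →
        inner ℂ (π g ξ) (C (D ξ)) = inner ℂ (T g (C ξ)) (D ξ) := by
      intro C D hC hD hCπ hDπ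
      have h1 : P (C (D ξ)) = C (D ξ) := by
        have := DFunLike.congr_fun ((hPA hC hCπ).mul_left (hPA hD hDπ)) ξ
        simp only [mul_apply_eq_comp] at this
        rw [← this, hPv ξ hξ]
      have h2 : T g (C ξ) = C (T g ξ) :=
        (DFunLike.congr_fun (hCT hC hCπ (T g) (Submodule.subset_span ⟨g, rfl⟩)) ξ).symm
      rw [h2, hadj C, hC, ← h1]
      have h3 : T g ξ = P (π g ξ) := by simp [T, hPv ξ hξ]
      rw [h3, hadj P, hPs, h1, h1]
    rw [hfix hA hB hAπ hBπ, hfix hB hA hBπ hAπ]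
    -- The approximants ⟨T(g)aₙ*ξ, bₙξ⟩ = ⟨ξ, aₙT(g)*bₙξ⟩ are unchanged when aₙ and bₙ are
    -- exchanged, since all factors lie in the commuting family 𝒜; hence the two limits agree.
    have l1 := ((((T g).continuous.tendsto _).comp has).inner hbl : Tendsto _ _ (𝓝 (inner ℂ _ _)))
    have l2 := ((((T g).continuous.tendsto _).comp hbs).inner hal : Tendsto _ _ (𝓝 (inner ℂ _ _)))
    refine tendsto_nhds_unique l1 (l2.congr fun n => ?_)
    have hTg : T g ∈ 𝒜 := Submodule.subset_span ⟨g, rfl⟩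
    have e : ∀ x y : H →L[ℂ] H, inner ℂ (T g (star x ξ)) (y ξ) =
        inner ℂ ξ ((x * star (T g) * y) ξ) := by
      intro x y
      rw [hadj, hadj, star_star]
      rfl
    have c1 := h𝒜c _ (ha n) _ (h𝒜s _ hTg)
    have c2 := h𝒜c _ (hb n) _ (h𝒜s _ hTg)
    have c3 := h𝒜c _ (ha n) _ (hb n)
    simp only [Function.comp_apply]
    rw [e, e, c2.eq, c1.eq, mul_assoc, mul_assoc, c3.eq]
  refine ContinuousLinearMap.ext_total ht fun g => ?_
  have h1 := DFunLike.congr_fun ((hAπ g).mul_left (hBπ g)) ξ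
  have h2 := DFunLike.congr_fun ((hBπ g).mul_left (hAπ g)) ξ
  simp only [mul_apply_eq_comp] at h1 h2 ⊢
  rw [h1, h2, hvec]

end Commutant

/-! ### Order theory: positive parts and lattice cones. -/

/-- In a C⋆-algebra, the positive part `d⁺` is the least positive element above `d` among those
commuting with `d`. -/
theorem CStarAlgebra.posPart_le_of_commute {A : Type*} [CStarAlgebra A] [PartialOrder A]
    [StarOrderedRing A] {x d : A} (hd : IsSelfAdjoint d) (hx : 0 ≤ x) (hdx : d ≤ x)
    (hc : Commute x d) : d⁺ ≤ x := by
  have h1 : 0 ≤ x * (x - d) :=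
    Commute.mul_nonneg hx (sub_nonneg.2 hdx) ((Commute.refl x).sub_right hc)
  -- Here (2x - d)² - d² = 4x(x - d) ≥ 0. Operator monotonicity of the square root gives |d| ≤ 2x -
  -- d, hence 2d⁺ = |d| + d ≤ 2x.
  have h2 : d * d ≤ (x + (x - d)) * (x + (x - d)) := by
    have : (x + (x - d)) * (x + (x - d)) - d * d = (2 : ℝ) • (x * (x - d)) + (2 : ℝ) • (x * (x - d)) := by
      simp only [two_smul, mul_add, add_mul, mul_sub, sub_mul, hc.eq]
      abel
    rw [← sub_nonneg, this]
    positivity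
  have h3 : CFC.abs d ≤ x + (x - d) := by
    have h4 := CFC.sqrt_le_sqrt _ _ h2
    rw [CFC.sqrt_mul_self _ (add_nonneg hx (sub_nonneg.2 hdx))] at h4
    rwa [CFC.abs, hd.star_eq]
  have h5 : (2 : ℝ) • d⁺ ≤ (2 : ℝ) • x := by
    have := CFC.abs_add_self d hd
    rw [two_smul] at this
    rw [two_smul, two_smul, ← this]
    calc CFC.abs d + d ≤ x + (x - d) + d := by gcongr
      _ = x + x := by abel
  exact (smul_le_smul_iff_of_pos_left (by norm_num : (0 : ℝ) < 2)).1 h5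

/-- A convex cone is a lattice as soon as any two of its elements have a greatest lower bound. -/
theorem PointedCone.isLatticeCone_of_exists_inf {E : Type*} [AddCommGroup E] [Module ℝ E]
    {Γ : PointedCone ℝ E}
    (h : ∀ x ∈ Γ, ∀ y ∈ Γ, ∃ i ∈ Γ, Γ.ConeLE i x ∧ Γ.ConeLE i y ∧
      ∀ l ∈ Γ, Γ.ConeLE l x → Γ.ConeLE l y → Γ.ConeLE l i) : Γ.IsLatticeCone := by
  intro x hx y hy
  refine ⟨?_, h x hx y hy⟩
  obtain ⟨i, hi, hix, hiy, hmax⟩ := h x hx y hy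
  simp only [PointedCone.ConeLE] at *
  -- The supremum is x + y - i, as in a vector lattice.
  refine ⟨x + (y - i), Γ.add_mem hx hiy, by simpa using hiy, ?_, fun u hu hxu hyu => ?_⟩
  · simpa [add_sub_right_comm, add_sub_assoc] using hix
  -- Infima are only tested against elements of Γ, so the comparison is made after translating by u:
  -- m - u lies in Γ and below i, while x + y lies below m. Adding the two gives x + y - i ≪ u.
  obtain ⟨m, -, hmx, hmy, hm⟩ := h (x + u) (Γ.add_mem hx hu) (y + u) (Γ.add_mem hy hu)
  have h1 : m - u ∈ Γ := hm u hu (by simpa using hx) (by simpa using hy)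
  have h2 : i - (m - u) ∈ Γ := by
    refine hmax _ h1 ?_ ?_
    · convert hmx using 1; abel
    · convert hmy using 1; abel
  have h3 : m - (x + y) ∈ Γ := by
    refine hm _ (Γ.add_mem hx hy) ?_ ?_
    · convert hyu using 1; abel
    · convert hxu using 1; abel
  convert Γ.add_mem h2 h3 using 1
  abel

/-! ### The infimum for a Gelfand pair. -/

/-- Two biinvariant functions of positive type have a greatest lower bound for a Gelfand pair. -/
theorem IsGelfandPair.exists_inf {G : Type u} [Group G] [TopologicalSpace G] [IsTopologicalGroup G]
    [LocallyCompactSpace G] [MeasurableSpace G] [BorelSpace G] {K : Subgroup G}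
    (hGK : IsGelfandPair G K) {φ ψ : G → ℂ} (hφ : φ ∈ biinvariantPositiveCone K)
    (hψ : ψ ∈ biinvariantPositiveCone K) :
    ∃ i ∈ biinvariantPositiveCone K, (biinvariantPositiveCone K).ConeLE i φ ∧
      (biinvariantPositiveCone K).ConeLE i ψ ∧ ∀ l ∈ biinvariantPositiveCone K,
        (biinvariantPositiveCone K).ConeLE l φ → (biinvariantPositiveCone K).ConeLE l ψ →
          (biinvariantPositiveCone K).ConeLE l i := by
  have hχ := (biinvariantPositiveCone K).add_mem hφ hψ
  obtain ⟨H, _, _, _, e, ht, he⟩ := hχ.2.1.exists_gram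
  obtain ⟨π, hπ, hπe⟩ := exists_isUnitaryRep_of_gram hχ.1 ht he
  have hs := hπ.star_map
  have hξ : ∀ k ∈ K, π k (e 1) = e 1 := fun k hk => rep_fixes_cyclic_vector ht he hπe hχ.2.2 hk
  have hdom : ∀ l : G → ℂ, IsPositiveType l → IsPositiveType (φ + ψ - l) →
      ∃ L : H →L[ℂ] H, 0 ≤ L ∧ (∀ g, Commute L (π g)) ∧
        ∀ x y, inner ℂ (e x) (L (e y)) = l (x⁻¹ * y) := fun l h1 h2 =>
    exists_nonneg_commute_of_dominated ht he hs hπe h1 h2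
  have hcoef : ∀ {L : H →L[ℂ] H} {l : G → ℂ}, (∀ x y, inner ℂ (e x) (L (e y)) = l (x⁻¹ * y)) →
      (fun g => inner ℂ (e 1) (L (π g (e 1)))) = l := by
    intro L l hL
    funext g
    rw [hπe, hL]
    simp
  obtain ⟨P, hPs, hP, hP', hPv⟩ := exists_fixed_projection hs K
  have ht' : (Submodule.span ℂ (Set.range fun g => π g (e 1))).topologicalClosure = ⊤ := by
    simpa only [hπe, mul_one] using ht
  have hcommute : ∀ {A B : H →L[ℂ] H}, star A = A → star B = B → (∀ g, Commute A (π g)) →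
      (∀ g, Commute B (π g)) → Commute A B := fun hA hB hAπ hBπ =>
    commute_of_commute_rep hs hPs hP hPv
      (fun u v hu hv => hGK.inner_rep_comm hπ hP hP' hPv hu hv) hξ ht' hA hB hAπ hBπ
  obtain ⟨A, hA, hAπ, hAe⟩ := hdom φ hφ.2.1 (by simpa using hψ.2.1)
  obtain ⟨B, hB, hBπ, hBe⟩ := hdom ψ hψ.2.1 (by simpa using hφ.2.1)
  have hAs : IsSelfAdjoint A := IsSelfAdjoint.of_nonneg hA
  have hBs : IsSelfAdjoint B := IsSelfAdjoint.of_nonneg hB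
  have hDs : IsSelfAdjoint (A - B) := hAs.sub hBs
  have hposπ : ∀ g, Commute (A - B)⁺ (π g) := fun g => by
    have h : Commute (A - B) (π g) := (hAπ g).sub_left (hBπ g)
    rw [CFC.posPart_def]
    exact h.cfcₙ_real _
  have hneg : B - (A - (A - B)⁺) = (A - B)⁻ := by
    have := CFC.posPart_sub_negPart (A - B) hDs
    rw [sub_eq_iff_eq_add] at this
    rw [this]
    abel
  have hmem := fun {C : H →L[ℂ] H} (hC : 0 ≤ C) (hCπ : ∀ g, Commute C (π g)) =>
    mem_biinvariantPositiveCone_of_nonneg hπ hξ hC hCπ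
  -- For X below A and B, the operator A - X is positive, dominates A - B and commutes with it by
  -- the Gelfand property; hence it dominates (A - B)⁺. The case X = 0 shows that the candidate is
  -- positive.
  have hI : ∀ {X : H →L[ℂ] H}, 0 ≤ X → X ≤ A → X ≤ B → (∀ g, Commute X (π g)) →
      X ≤ A - (A - B)⁺ := by
    intro X hX hXA hXB hXπ
    rw [le_sub_comm]
    have hXs : IsSelfAdjoint X := IsSelfAdjoint.of_nonneg hX
    refine CStarAlgebra.posPart_le_of_commute hDs (sub_nonneg.2 hXA) (sub_le_sub_left hXB A) ?_
    exact hcommute (hAs.sub hXs).star_eq hDs.star_eq (fun g => (hAπ g).sub_left (hXπ g))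
      fun g => (hAπ g).sub_left (hBπ g)
  have hIπ : ∀ g, Commute (A - (A - B)⁺) (π g) := fun g => (hAπ g).sub_left (hposπ g)
  have hsub : ∀ {C D : H →L[ℂ] H}, C ≤ D → (∀ g, Commute C (π g)) → (∀ g, Commute D (π g)) →
      (fun g => inner ℂ (e 1) (D (π g (e 1)))) - (fun g => inner ℂ (e 1) (C (π g (e 1)))) ∈
        biinvariantPositiveCone K := by
    intro C D hCD hC hD
    convert hmem (sub_nonneg.2 hCD) (fun g => (hD g).sub_left (hC g)) using 1
    funext g
    simp
  refine ⟨fun g => inner ℂ (e 1) ((A - (A - B)⁺) (π g (e 1))),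
    hmem (hI le_rfl hA hB fun g => Commute.zero_left _) hIπ, ?_, ?_, fun l hl hlφ hlψ => ?_⟩
  · have := hsub (sub_le_self A (CFC.posPart_nonneg (A - B))) hIπ hAπ
    rwa [hcoef hAe] at this
  · have := hsub (sub_nonneg.1 (hneg ▸ CFC.negPart_nonneg (A - B))) hIπ hBπ
    rwa [hcoef hBe] at this
  · have hχl : φ + ψ - l ∈ biinvariantPositiveCone K := by
      rw [add_sub_right_comm]
      exact (biinvariantPositiveCone K).add_mem hlφ hψ
    obtain ⟨L, hL, hLπ, hLe⟩ := hdom l hl.2.1 hχl.2.1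
    -- The positive operator representing c - l must be C - L, as both have the same coefficients on
    -- a total family. The domination hypothesis holds because φ + ψ - (φ - l) = ψ + l, and
    -- symmetrically for ψ.
    have hle : ∀ {C : H →L[ℂ] H} {c : G → ℂ}, IsPositiveType (c - l) →
        IsPositiveType (φ + ψ - (c - l)) →
        (∀ x y, inner ℂ (e x) (C (e y)) = c (x⁻¹ * y)) → L ≤ C := by
      intro C c h1 h2 hC
      obtain ⟨M, hM, -, hMe⟩ := hdom _ h1 h2
      have : M = C - L := by
        refine ContinuousLinearMap.ext_total ht fun y => eq_of_forall_inner_total ht fun x => ?_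
        rw [hMe, sub_apply, inner_sub_right, hC, hLe]
        rfl
      exact sub_nonneg.1 (this ▸ hM)
    have hLA : L ≤ A := by
      refine hle hlφ.2.1 ?_ hAe
      convert ((biinvariantPositiveCone K).add_mem hψ hl).2.1 using 1
      abel
    have hLB : L ≤ B := by
      refine hle hlψ.2.1 ?_ hBe
      convert ((biinvariantPositiveCone K).add_mem hφ hl).2.1 using 1
      abel
    have := hsub (hI hL hLA hLB hLπ) hLπ hIπ
    rwa [hcoef hLe] at this

theorem corollary1 {G : Type*} [Group G] [TopologicalSpace G] [IsTopologicalGroup G] [T2Space G]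
    [LocallyCompactSpace G] [MeasurableSpace G] [BorelSpace G]
    (K : Subgroup G) (hGK : IsGelfandPair G K) :
    (biinvariantPositiveCone K).IsLatticeCone :=
  PointedCone.isLatticeCone_of_exists_inf fun _ hx _ hy => hGK.exists_inf hx hy
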